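/- All graphs are finite and simple. A \emph{Barnette graph} is a $3$-regular, $3$-connected, planar, bipartite graph. \textbf{Annular embeddings.} A \emph{planar annular embedding with $n$ annuli} of a Barnette graph $G$ is a planar embedding of $G$ together with pairwise disjoint nested cycles $C_0, C_1, \dots, C_n$ of $G$ (numbered from the inside to the outside) that contain all vertices of $G$, such that the interior of $C_0$ is a face (the interior face), the exterior of $C_n$ is a face (the exterior face), and every edge of $G$ either is an edge of some $C_k$, or joins a vertex of $C_{k-1}$ to a vertex of $C_k$ for some $1 \le k \le n$. The $k$-th annulus $A_k$ $(1 \le k \le n)$ is the closed region between its inner boundary $C_{k-1}$ and its outer boundary $C_k$; the edges between $C_{k-1}$ and $C_k$ are the edges \emph{in the interior of $A_k$}, and the faces inside $A_k$ are the faces \emph{of $A_k$}. \textbf{ADB-AC graphs.} Deleting the edges in the interior of $A_k$ along with their end vertices means removing these edges and then suppressing their end vertices (which have become vertices of degree two on $C_{k-1}$ and $C_k$). The graph $G$ with its annular embedding is \emph{annular connected} (an ADB-AC graph) if $n > 2$ and, for every $1 \le k \le n$, this deletion leaves two separate Barnette graphs, or a Barnette graph and a closed curve without vertices. For $1 \le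 k < n$, the \emph{$k$-annular restriction} $G_k$ is the part inside $A_{k+1}$ that is left after this deletion for $A_{k+1}$; its outermost annulus is $A_k$. \textbf{Block and ring annuli.} Two faces are adjacent if they share an edge. For $k \ge 3$, the annulus $A_k$ is a \emph{block annulus} if the faces of $A_{k-1}$ can be split into two classes, neither of which contains two adjacent faces, such that all faces in one of the classes are $4$-cycles of $G_{k-1}$ and every edge in the interior of $A_k$ is attached to a face of this class (that is, its end vertex on $C_{k-1}$ lies on the boundary of such a face); otherwise $A_k$ is a \emph{ring annulus}. The annuli $A_1$ and $A_2$ count both as block annuli and as ring annuli. \textbf{Theorem.} Let $x \ge 1$ and $y \ge 1$, and let $G$ be an ADB-AC graph with a planar annular embedding that has $x + y$ annuli, of which $A_1, \dots, A_x$ are block annuli and $A_{x+1}, \dots, A_{x+y}$ are ring annuli. Then $G$ is Hamiltonian. -/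

import Mathlib

namespace BarnetteAnnular

/-- A graph is `3`-connected: it has at least four vertices, and it stays connected when at most
two vertices are deleted. -/
def IsThreeConnected {V : Type*} [Finite V] (G : SimpleGraph V) : Prop :=
  4 ≤ Nat.card V ∧ ∀ S : Set V, S.ncard ≤ 2 → (G.induce Sᶜ).Connected

/-- A planar embedding of a finite graph, up to homeomorphism, given by its rotation system.
`rot` sends a dart (a directed edge) to the next dart with the same tail in counterclockwise order;
the orbits of `rot` are thus the sets of darts leaving the individual vertices. The faces are the
orbits of the permutation `facePerm` below, which walks along a face keeping it on the left.
Euler's formula says that the surface on which the rotation system draws the graph is the sphere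
(one sphere for each component; an isolated vertex lies in a face that has no darts). -/
structure PlanarEmbedding {V : Type*} [Finite V] (G : SimpleGraph V) where
  rot : Equiv.Perm G.Dart
  sameCycle_rot_iff : ∀ d e : G.Dart, rot.SameCycle d e ↔ d.fst = e.fst
  euler : Nat.card V +
      (Nat.card (Quotient (Equiv.Perm.SameCycle.setoid
        ((SimpleGraph.Dart.symm_involutive (G := G)).toPerm.trans rot.symm))) +
        Nat.card {v : V // ∀ w, ¬ G.Adj v w}) =
    Nat.card G.edgeSet + 2 * Nat.card G.ConnectedComponent

namespace PlanarEmbedding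

variable {V : Type*} [Finite V] {G : SimpleGraph V}

/-- From the dart `d`, go to its head and leave it by the dart that comes just before the reverse
of `d` in counterclockwise order. This keeps the face to the left of `d` on the left. -/
def facePerm (E : PlanarEmbedding G) : Equiv.Perm G.Dart :=
  (SimpleGraph.Dart.symm_involutive (G := G)).toPerm.trans E.rot.symm

/-- The faces of an embedded graph. -/
abbrev Face (E : PlanarEmbedding G) : Type _ :=
  Quotient (Equiv.Perm.SameCycle.setoid E.facePerm)

/-- The face to the left of a dart. -/
def leftFace (E : PlanarEmbedding G) (d : G.Dart) : E.Face :=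
  Quotient.mk (Equiv.Perm.SameCycle.setoid E.facePerm) d

/-- The vertices on the boundary of a face. -/
def faceVerts (E : PlanarEmbedding G) (f : E.Face) : Set V :=
  {v | ∃ d : G.Dart, d.fst = v ∧ E.leftFace d = f}

/-- Two faces are adjacent: some edge has one of them on one side and the other one on the other
side. -/
def FaceAdj (E : PlanarEmbedding G) (f g : E.Face) : Prop :=
  ∃ d : G.Dart, E.leftFace d = f ∧ E.leftFace d.symm = g

end PlanarEmbedding

/-- Barnette graphs: cubic, `3`-connected, planar and bipartite (simple, finite) graphs. -/
structure IsBarnette {V : Type*} [Finite V] (G : SimpleGraph V) : Prop where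
  cubic : ∀ v, (G.neighborSet v).ncard = 3
  threeConnected : IsThreeConnected G
  planar : Nonempty (PlanarEmbedding G)
  bipartite : G.IsBipartite

/-- A planar annular embedding, with `n` annuli, of a cubic graph `G`. The vertices lie on `n + 1`
nested closed curves, numbered `0, …, n` from the inside to the outside; `level v` is the number of
the curve through `v`. Every curve is a cycle of `G`, and `next v` is the vertex that follows `v` on
its curve in counterclockwise direction. The `k`-th annulus (`1 ≤ k ≤ n`) is the region between the
curves `k - 1` and `k`. Every edge either is an edge of one of the curves, or crosses one annulus
from its inner to its outer boundary. The fields `rot_outward` and `rot_inward` say that the curves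
are nested in the given order: at a vertex of a curve, an edge to the next larger curve leaves to
the right of the counterclockwise direction of travel (so the counterclockwise order is outward
edge, `next v`, previous vertex), and an edge to the next smaller curve leaves to the left
of it (so the order is inward edge, previous vertex, `next v`). In particular no edge enters the
disc bounded by curve `0` or the exterior of curve `n`: these are the interior face and the exterior
face. -/
structure AnnularEmbedding {V : Type*} [Finite V] (G : SimpleGraph V) (n : ℕ) extends
    PlanarEmbedding G where
  level : V → ℕ
  next : Equiv.Perm V
  level_le : ∀ v, level v ≤ n
  exists_level : ∀ k ≤ n, ∃ v, level v = k
  adj_next : ∀ v, G.Adj v (next v)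
  next_next_ne : ∀ v, next (next v) ≠ v
  sameCycle_next_iff : ∀ u v, next.SameCycle u v ↔ level u = level v
  adj_cases : ∀ u v, G.Adj u v →
    v = next u ∨ u = next v ∨ level v = level u + 1 ∨ level u = level v + 1
  rot_outward : ∀ d : G.Dart, level d.snd = level d.fst + 1 → (rot d).snd = next d.fst
  rot_inward : ∀ d : G.Dart, level d.fst = level d.snd + 1 → (rot d).snd = next.symm d.fst

namespace AnnularEmbedding

variable {V : Type*} [Finite V] {G : SimpleGraph V} {n : ℕ}

/-- The edge `uv` lies in the interior of the `k`-th annulus (when `u`, `v` are adjacent). -/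
def Crosses (A : AnnularEmbedding G n) (k : ℕ) (u v : V) : Prop :=
  (A.level u + 1 = k ∧ A.level v = k) ∨ (A.level v + 1 = k ∧ A.level u = k)

/-- The vertices that are not incident with an edge in the interior of the `k`-th annulus. -/
def survivors (A : AnnularEmbedding G n) (k : ℕ) : Set V :=
  {v | ∀ w, G.Adj v w → ¬ A.Crosses k v w}

/-- The vertices left inside the `k`-th annulus (its inner boundary included), after deletion of the
edges in the interior of the `k`-th annulus along with their end vertices. -/
def innerVerts (A : AnnularEmbedding G n) (k : ℕ) : Set V :=
  {v | v ∈ A.survivors k ∧ A.level v < k}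

/-- The vertices left outside the `k`-th annulus (its outer boundary included), after deletion of
the edges in the interior of the `k`-th annulus along with their end vertices. -/
def outerVerts (A : AnnularEmbedding G n) (k : ℕ) : Set V :=
  {v | v ∈ A.survivors k ∧ k ≤ A.level v}

/-- `v` is the first vertex of `S` after `u` on the curve through `u`. -/
def Follows (A : AnnularEmbedding G n) (S : Set V) (u v : V) : Prop :=
  v ∈ S ∧ ∃ m : ℕ, A.next^[m + 1] u = v ∧ ∀ i < m, A.next^[i + 1] u ∉ S

/-- The graph on the vertex set `S` that is left when the vertices outside `S` are erased from
the curves that they lie on (the curves themselves stay). Its edges are the edges of `G` between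
different curves with both ends in `S`, and the arcs of the curves between successive vertices
of `S`. -/
def erase (A : AnnularEmbedding G n) (S : Set V) : SimpleGraph S where
  Adj u v := u ≠ v ∧ ((G.Adj u v ∧ A.level u ≠ A.level v) ∨ A.Follows S u v ∨ A.Follows S v u)
  symm := ⟨fun _ _ h => ⟨h.1.symm, h.2.elim (fun h => Or.inl ⟨h.1.symm, h.2.symm⟩)
    (fun h => Or.inr h.symm)⟩⟩
  loopless := ⟨fun _ h => h.1 rfl⟩

/-- The embedded graph is annular connected: it has more than two annuli, and deleting the edges in
the interior of any annulus (along with their end vertices) leaves two Barnette graphs, or a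
Barnette graph and a closed curve without vertices. -/
def IsAnnularConnected (A : AnnularEmbedding G n) : Prop :=
  2 < n ∧ ∀ k, 1 ≤ k → k ≤ n →
    (IsBarnette (A.erase (A.innerVerts k)) ∧ IsBarnette (A.erase (A.outerVerts k))) ∨
    (A.innerVerts k = ∅ ∧ IsBarnette (A.erase (A.outerVerts k))) ∨
    (IsBarnette (A.erase (A.innerVerts k)) ∧ A.outerVerts k = ∅)

/-- The faces in the `k`-th annulus. -/
def annulusFaces (A : AnnularEmbedding G n) (k : ℕ) : Set A.Face :=
  {f | ∃ d : G.Dart, A.Crosses k d.fst d.snd ∧ A.leftFace d = f}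

/-- The faces of the `k`-th annulus are split into two classes `P` and `annulusFaces k \ P` such that
no two faces in the same class are adjacent. -/
def IsFacePartition (A : AnnularEmbedding G n) (k : ℕ) (P : Set A.Face) : Prop :=
  P ⊆ A.annulusFaces k ∧ P.Pairwise (fun f g => ¬ A.FaceAdj f g) ∧
    (A.annulusFaces k \ P).Pairwise (fun f g => ¬ A.FaceAdj f g)

/-- The face `f` of the `k`-th annulus is a `4`-cycle in the restriction of the graph to the first
`k` annuli, that is, when the end vertices of the edges in the `(k + 1)`-st annulus are
disregarded. -/
def IsFourCycleInRestriction (A : AnnularEmbedding G n) (k : ℕ) (f : A.Face) : Prop :=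
  (A.faceVerts f ∩ A.innerVerts (k + 1)).ncard = 4

/-- The edges in the interior of the `(k + 1)`-st annulus are attached to the faces of the `k`-th
annulus in such a way that they are all attached to faces of one class of the face partition of the
`k`-th annulus, and this class consists of `4`-cycles only (in the restriction of the graph to
the first `k` annuli). -/
def AttachedToFourFaces (A : AnnularEmbedding G n) (k : ℕ) : Prop :=
  ∃ P : Set A.Face, A.IsFacePartition k P ∧ (∀ f ∈ P, A.IsFourCycleInRestriction k f) ∧
    ∀ u v, G.Adj u v → A.level u = k → A.level v = k + 1 → ∃ f ∈ P, u ∈ A.faceVerts f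

/-- The `k`-th annulus is a block annulus: the edges in its interior are attached to the class of
`4`-cycles among the faces of the annulus before it. The first and the second annulus count both as
block annuli and as ring annuli. -/
def IsBlock (A : AnnularEmbedding G n) (k : ℕ) : Prop :=
  k ≤ 2 ∨ A.AttachedToFourFaces (k - 1)

/-- The `k`-th annulus is a ring annulus: it is one of the first two annuli, or it is not attached
to the annulus before it in the way required of block annuli. -/
def IsRing (A : AnnularEmbedding G n) (k : ℕ) : Prop :=
  k ≤ 2 ∨ ¬ A.AttachedToFourFaces (k - 1)

end AnnularEmbedding

end BarnetteAnnular

/-! Fix a proper 2-colouring of `G`. Each vertex has one edge off its curve, pointing outwards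
(`outs`) or inwards (`ins`). Along every curve the colour alternates on successive outward vertices,
and also on successive inward ones (`color_ne_of_follows_outs`, `color_ne_of_follows_ins`). Two
facts give this: Euler's formula forces the edges crossing an annulus to have the same cyclic order
at both ends (`partner_eq_of_follows`), and the graph left inside the next annulus after deletion is
again bipartite. Consequently all vertices of a curve after which the direction changes share one
colour (`exists_color_of_change`), so outward vertices of the other colour `b` are followed by
outward vertices.

A cycle through the curves `0, …, k` is grown curve by curve, keeping on it every edge of curve `k`
between two outward vertices (`IsCycleMap`). It thus contains each edge from an outward `v` of
colour `b` to `next v`. On curve `k + 1` there is likewise a colour whose inward vertices are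
followed by inward vertices. If it is `b`, each of these edges is replaced by a detour along the arc
of curve `k + 1` facing it; the skipped arcs are single edges, so all vertices are covered
(`exists_replace`). If it is the other colour, each of these edges lies on a 4-cycle with an edge of
curve `k + 1`, and switching along one such 4-cycle absorbs the whole curve (`exists_merge`). -/

namespace BarnetteAnnular

open SimpleGraph Function

/-! ### Cycles as transitive self-maps -/

/-- A self-map of a finite vertex set that moves every vertex to a neighbour and whose iterates
connect any two vertices runs through a Hamiltonian cycle. -/
theorem isHamiltonian_of_transitive {V : Type*} [Fintype V] [DecidableEq V] {G : SimpleGraph V}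
    (f : V → V) (hadj : ∀ v, G.Adj v (f v)) (htrans : ∀ u v, ∃ m, f^[m] u = v)
    (hcard : 3 ≤ Fintype.card V) : G.IsHamiltonian := by
  intro _
  obtain ⟨v₀⟩ : Nonempty V := Fintype.card_pos_iff.1 (by omega)
  have hper : ∀ v, v ∈ periodicPts f := by
    intro v
    obtain ⟨m, hm⟩ := htrans (f v) v
    exact ⟨m + 1, Nat.succ_pos _, hm⟩
  have hsurj : ∀ v, ∃ i < minimalPeriod f v₀, f^[i] v₀ = v := by
    intro v
    obtain ⟨m, rfl⟩ := htrans v₀ v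
    exact ⟨m % minimalPeriod f v₀, Nat.mod_lt _ (minimalPeriod_pos_of_mem_periodicPts (hper v₀)),
      iterate_mod_minimalPeriod_eq⟩
  have hinj : ∀ i < minimalPeriod f v₀, ∀ j < minimalPeriod f v₀,
      f^[i] v₀ = f^[j] v₀ → i = j := by
    intro i hi j hj h
    exact (iterate_eq_iterate_iff_of_lt_minimalPeriod hi hj).1 h
  have hN : minimalPeriod f v₀ = Fintype.card V := by
    rw [← Fintype.card_fin (minimalPeriod f v₀)]
    refine Fintype.card_of_bijective (f := fun i : Fin (minimalPeriod f v₀) => f^[i] v₀) ⟨?_, ?_⟩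
    · intro i j h
      exact Fin.ext (hinj i i.2 j j.2 h)
    · intro v
      obtain ⟨i, hi, h⟩ := hsurj v
      exact ⟨⟨i, hi⟩, h⟩
  have hwalk : ∀ m, ∃ q : G.Walk v₀ (f^[m] v₀),
      q.support = (List.range (m + 1)).map (fun i => f^[i] v₀) := by
    intro m
    induction m with
    | zero => exact ⟨Walk.nil, by simp⟩
    | succ m ih =>
      obtain ⟨q, hq⟩ := ih
      have h := hadj (f^[m] v₀)
      rw [← iterate_succ_apply' f] at h
      refine ⟨q.concat h, ?_⟩
      rw [Walk.support_concat, hq, List.range_succ (n := m + 1)]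
      simp
  obtain ⟨k, hk⟩ : ∃ k, minimalPeriod f v₀ = k + 1 := ⟨minimalPeriod f v₀ - 1, by omega⟩
  obtain ⟨q, hq⟩ := hwalk k
  have hlen : q.length = k := by
    have := congrArg List.length hq
    simpa using this
  have hpath : q.IsPath := by
    rw [Walk.isPath_def, hq]
    refine List.Nodup.map_on ?_ List.nodup_range
    intro i hi j hj h
    rw [List.mem_range] at hi hj
    exact hinj i (by omega) j (by omega) h
  have hclose : G.Adj (f^[k] v₀) v₀ := by
    have h := hadj (f^[k] v₀)
    rwa [← iterate_succ_apply' f, Nat.succ_eq_add_one, ← hk, iterate_minimalPeriod] at h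
  refine ⟨_, Walk.cons hclose q, ?_⟩
  rw [Walk.isHamiltonianCycle_iff_isCycle_and_length_eq]
  refine ⟨?_, by rw [Walk.length_cons, hlen]; omega⟩
  rw [Walk.isCycle_iff_isPath_tail_and_le_length, Walk.length_cons, hlen]
  exact ⟨by simpa using hpath, by omega⟩

/-- If the iterates of `f` connect any two elements of the finite set `S`, then `f` has an inverse
on `S` with the same property. -/
theorem exists_inverse_of_transitive {V : Type*} [Finite V] (S : Set V)
    (f : V → V) (hf : Set.MapsTo f S S) (htrans : ∀ u ∈ S, ∀ v ∈ S, ∃ m, f^[m] u = v) :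
    ∃ g : V → V, Set.MapsTo g S S ∧ (∀ v ∈ S, g (f v) = v) ∧ (∀ v ∈ S, f (g v) = v) ∧
      ∀ u ∈ S, ∀ v ∈ S, ∃ m, g^[m] u = v := by
  classical
  have hsurj : Set.SurjOn f S S := by
    intro v hv
    obtain ⟨m, hm⟩ := htrans (f v) (hf hv) v hv
    refine ⟨f^[m] v, hf.iterate m hv, ?_⟩
    rw [← iterate_succ_apply' f, iterate_succ_apply, hm]
  have hinj : Set.InjOn f S := by
    have hfin : S.Finite := S.toFinite
    exact hfin.injOn_of_encard_image_eq
      (by rw [hsurj.image_eq_of_mapsTo hf])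
  have hbij : Set.BijOn f S S := ⟨hf, hinj, hsurj⟩
  rcases isEmpty_or_nonempty V with hV | hV
  · exact ⟨f, hf, fun v => (hV.false v).elim, fun v => (hV.false v).elim, fun v => (hV.false v).elim⟩
  have hinv := hbij.invOn_invFunOn
  have hmaps : Set.MapsTo (invFunOn f S) S S := hsurj.mapsTo_invFunOn
  refine ⟨invFunOn f S, hmaps, hinv.1, hinv.2, ?_⟩
  have key : ∀ m, ∀ v ∈ S, (invFunOn f S)^[m] (f^[m] v) = v := by
    intro m
    induction m with
    | zero => intro v _; rfl
    | succ m ih =>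
      intro v hv
      rw [iterate_succ_apply' f, iterate_succ_apply, hinv.1 (hf.iterate m hv), ih v hv]
  intro u hu v hv
  obtain ⟨m, hm⟩ := htrans v hv u hu
  exact ⟨m, by rw [← hm, key m v hv]⟩

/-! ### Curves and the third edge at each vertex -/

namespace AnnularEmbedding

variable {V : Type*} [Finite V] {G : SimpleGraph V} {n : ℕ} (A : AnnularEmbedding G n)

/-- The vertices from which an edge leads to the next larger curve. -/
def outs : Set V := {v | ∃ w, G.Adj v w ∧ A.level w = A.level v + 1}

/-- The vertices from which an edge leads to the next smaller curve. -/
def ins : Set V := {v | ∃ w, G.Adj v w ∧ A.level v = A.level w + 1}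

open Classical in
/-- The other end of the edge at `v` that does not belong to the curve through `v`. -/
noncomputable def partner (v : V) : V :=
  -- In a cubic graph the default `v` never occurs: two neighbours on the curve leave a third one.
  if h : ∃ w, G.Adj v w ∧ w ≠ A.next v ∧ w ≠ A.next.symm v then h.choose else v

theorem level_next (v : V) : A.level (A.next v) = A.level v :=
  (A.sameCycle_next_iff _ _).1 ((Equiv.Perm.sameCycle_apply_left).2 (Equiv.Perm.SameCycle.refl _ _))

theorem level_next_symm (v : V) : A.level (A.next.symm v) = A.level v := by
  rw [← A.level_next (A.next.symm v), Equiv.apply_symm_apply]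

theorem level_iterate (m : ℕ) (v : V) : A.level (A.next^[m] v) = A.level v := by
  induction m with
  | zero => rfl
  | succ m ih => rw [iterate_succ_apply', A.level_next, ih]

theorem adj_next_symm (v : V) : G.Adj v (A.next.symm v) := by
  have := (A.adj_next (A.next.symm v)).symm
  rwa [Equiv.apply_symm_apply] at this

theorem next_symm_ne_next (v : V) : A.next.symm v ≠ A.next v := fun h =>
  A.next_next_ne v (by rw [← h, Equiv.apply_symm_apply])

theorem exists_iterate_eq {u v : V} (h : A.level u = A.level v) :
    ∃ m : ℕ, A.next^[m + 1] u = v := by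
  obtain ⟨i, hi, -, h⟩ := ((A.sameCycle_next_iff u v).2 h).exists_pow_eq''
  obtain ⟨m, rfl⟩ : ∃ m, i = m + 1 := ⟨i - 1, by omega⟩
  exact ⟨m, by rw [← h, Equiv.Perm.iterate_eq_pow]⟩

/-- Induction along a curve. -/
theorem curve_induction {P : V → Prop} {u v : V} (huv : A.level u = A.level v) (hu : P u)
    (hstep : ∀ x, A.level x = A.level u → P x → P (A.next x)) : P v := by
  obtain ⟨m, rfl⟩ := A.exists_iterate_eq huv
  have key : ∀ i, P (A.next^[i] u) := by
    intro i
    induction i with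
    | zero => exact hu
    | succ i ih =>
      rw [iterate_succ_apply']
      exact hstep _ (A.level_iterate i u) ih
  exact key _

/-- Induction along a curve in clockwise direction. -/
theorem curve_induction_symm {P : V → Prop} {u v : V} (huv : A.level u = A.level v) (hu : P u)
    (hstep : ∀ x, A.level x = A.level u → P (A.next x) → P x) : P v := by
  by_contra hv
  exact A.curve_induction (P := fun x => ¬ P x) huv.symm hv
    (fun x hx h h' => h (hstep x (hx.trans huv.symm) h')) hu

theorem exists_follows {S : Set V} {u s : V} (hs : s ∈ S) (h : A.level u = A.level s) :
    ∃ v, A.Follows S u v := by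
  classical
  have hex : ∃ m, A.next^[m + 1] u ∈ S := by
    obtain ⟨m, rfl⟩ := A.exists_iterate_eq h
    exact ⟨m, hs⟩
  exact ⟨_, Nat.find_spec hex, Nat.find hex, rfl, fun i hi => Nat.find_min hex hi⟩

/-- The last point of `S` before `v`. This is not phrased with `Follows` because `v` need not lie in
`S`. -/
theorem exists_iterate_eq_of_mem {S : Set V} {v s : V} (hs : s ∈ S) (h : A.level s = A.level v) :
    ∃ u ∈ S, ∃ m, A.next^[m + 1] u = v ∧ ∀ i < m, A.next^[i + 1] u ∉ S := by
  classical
  have hex : ∃ m, ∃ u ∈ S, A.next^[m + 1] u = v := by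
    obtain ⟨m, hm⟩ := A.exists_iterate_eq h
    exact ⟨m, s, hs, hm⟩
  obtain ⟨u, hu, hm⟩ := Nat.find_spec hex
  -- A point of `S` strictly between `u` and `v` would start a shorter arc to `v`.
  refine ⟨u, hu, _, hm, fun i hi hi' => Nat.find_min hex (m := Nat.find hex - (i + 1)) (by omega) ?_⟩
  refine ⟨_, hi', ?_⟩
  rw [← iterate_add_apply]
  refine Eq.trans ?_ hm
  rw [show Nat.find hex - (i + 1) + 1 + (i + 1) = Nat.find hex + 1 by omega]

variable {A}

theorem Follows.level_eq {S : Set V} {u v : V} (h : A.Follows S u v) : A.level v = A.level u := by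
  obtain ⟨-, m, rfl, -⟩ := h
  exact A.level_iterate _ _

theorem Follows.unique {S : Set V} {u v w : V} (h : A.Follows S u v) (h' : A.Follows S u w) :
    v = w := by
  obtain ⟨hv, m, rfl, hm⟩ := h
  obtain ⟨hw, k, rfl, hk⟩ := h'
  rcases lt_trichotomy m k with hlt | rfl | hlt
  · exact (hk m hlt hv).elim
  · rfl
  · exact (hm k hlt hw).elim

/-- If the arcs had different lengths, the start of the shorter one would be a point of `S` strictly
inside the longer one. -/
theorem Follows.left_unique {S : Set V} {u v w : V} (hu : u ∈ S) (hv : v ∈ S)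
    (h : A.Follows S u w) (h' : A.Follows S v w) : u = v := by
  have key : ∀ {u v : V} {m k : ℕ}, v ∈ S → m < k → A.next^[m + 1] v = A.next^[k + 1] u →
      (∀ i < k, A.next^[i + 1] u ∉ S) → False := by
    intro u v m k hv hlt heq hk
    have : v = A.next^[k - m] u := by
      apply A.next.injective.iterate (m + 1)
      rw [heq, ← iterate_add_apply, show m + 1 + (k - m) = k + 1 by omega]
    apply hk (k - m - 1) (by omega)
    rw [show k - m - 1 + 1 = k - m by omega, ← this]
    exact hv
  obtain ⟨-, m, rfl, hm⟩ := h
  obtain ⟨-, k, heq, hk⟩ := h'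
  rcases lt_trichotomy m k with hlt | rfl | hlt
  · exact (key hu hlt heq.symm hk).elim
  · exact (A.next.injective.iterate (m + 1) heq).symm
  · exact (key hv hlt heq hm).elim

theorem follows_next {S : Set V} {u : V} (h : A.next u ∈ S) : A.Follows S u (A.next u) :=
  ⟨h, 0, rfl, fun _ hi => (Nat.not_lt_zero _ hi).elim⟩

variable (A) (hc : ∀ v, (G.neighborSet v).ncard = 3)

include hc

theorem exists_partner (v : V) : ∃ w, G.Adj v w ∧ w ≠ A.next v ∧ w ≠ A.next.symm v := by
  by_contra! h
  have hsub : G.neighborSet v ⊆ {A.next v, A.next.symm v} := by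
    intro w hw
    rw [Set.mem_insert_iff, Set.mem_singleton_iff]
    exact or_iff_not_imp_left.2 (h w hw)
  have := (Set.ncard_le_ncard hsub).trans (Set.ncard_insert_le _ _)
  rw [hc v, Set.ncard_singleton] at this
  omega

theorem adj_partner (v : V) : G.Adj v (A.partner v) := by
  rw [partner, dif_pos (A.exists_partner hc v)]
  exact (A.exists_partner hc v).choose_spec.1

theorem partner_ne_next (v : V) : A.partner v ≠ A.next v := by
  rw [partner, dif_pos (A.exists_partner hc v)]
  exact (A.exists_partner hc v).choose_spec.2.1

theorem partner_ne_next_symm (v : V) : A.partner v ≠ A.next.symm v := by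
  rw [partner, dif_pos (A.exists_partner hc v)]
  exact (A.exists_partner hc v).choose_spec.2.2

theorem eq_of_adj {v w : V} (h : G.Adj v w) :
    w = A.next v ∨ w = A.next.symm v ∨ w = A.partner v := by
  have hcard : ({A.next v, A.next.symm v, A.partner v} : Set V).ncard = 3 :=
    Set.ncard_eq_three.2 ⟨_, _, _, (A.next_symm_ne_next v).symm, (A.partner_ne_next hc v).symm,
      (A.partner_ne_next_symm hc v).symm, rfl⟩
  have hsub : ({A.next v, A.next.symm v, A.partner v} : Set V) ⊆ G.neighborSet v := by
    rintro w (rfl | rfl | rfl)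
    exacts [A.adj_next v, A.adj_next_symm v, A.adj_partner hc v]
  have heq := Set.eq_of_subset_of_ncard_le hsub (by rw [hcard, hc v])
  have hw : w ∈ G.neighborSet v := h
  rw [← heq] at hw
  exact hw

theorem partner_partner (v : V) : A.partner (A.partner v) = v := by
  rcases A.eq_of_adj hc (A.adj_partner hc v).symm with h | h | h
  · exact (A.partner_ne_next_symm hc v (A.next.injective (by rw [← h, Equiv.apply_symm_apply]))).elim
  · exact (A.partner_ne_next hc v (A.next.symm.injective (by rw [← h, Equiv.symm_apply_apply]))).elim
  · exact h.symm

theorem level_partner (v : V) :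
    A.level (A.partner v) = A.level v + 1 ∨ A.level v = A.level (A.partner v) + 1 := by
  rcases A.adj_cases _ _ (A.adj_partner hc v) with h | h | h | h
  · exact (A.partner_ne_next hc v h).elim
  · exact (A.partner_ne_next_symm hc v (A.next.injective (by rw [← h, Equiv.apply_symm_apply]))).elim
  · exact Or.inl h
  · exact Or.inr h

theorem eq_partner_of_adj {v w : V} (h : G.Adj v w) (hl : A.level v ≠ A.level w) :
    w = A.partner v := by
  rcases A.eq_of_adj hc h with rfl | rfl | h
  · exact (hl (A.level_next v).symm).elim
  · exact (hl (A.level_next_symm v).symm).elim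
  · exact h

theorem mem_outs_iff {v : V} : v ∈ A.outs ↔ A.level (A.partner v) = A.level v + 1 := by
  refine ⟨fun ⟨w, hw, hl⟩ => ?_, fun h => ⟨_, A.adj_partner hc v, h⟩⟩
  rw [← A.eq_partner_of_adj hc hw (by omega), hl]

theorem mem_ins_iff {v : V} : v ∈ A.ins ↔ A.level v = A.level (A.partner v) + 1 := by
  refine ⟨fun ⟨w, hw, hl⟩ => ?_, fun h => ⟨_, A.adj_partner hc v, h⟩⟩
  rw [← A.eq_partner_of_adj hc hw (by omega), hl]

theorem mem_ins_iff_notMem_outs {v : V} : v ∈ A.ins ↔ v ∉ A.outs := by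
  rw [A.mem_ins_iff hc, A.mem_outs_iff hc]
  have := A.level_partner hc v
  omega

theorem partner_mem_ins {v : V} : A.partner v ∈ A.ins ↔ v ∈ A.outs := by
  rw [A.mem_ins_iff hc, A.mem_outs_iff hc, A.partner_partner hc]

theorem partner_mem_outs {v : V} : A.partner v ∈ A.outs ↔ v ∈ A.ins := by
  rw [A.mem_ins_iff hc, A.mem_outs_iff hc, A.partner_partner hc]

/-- A walk from curve `k` to curve `k + 1` must leave the set of levels at most `k`, and only an
edge off a curve can do so. -/
theorem exists_mem_outs (hconn : G.Preconnected) {k : ℕ} (hk : k < n) :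
    ∃ v ∈ A.outs, A.level v = k := by
  obtain ⟨u, hu⟩ := A.exists_level k hk.le
  obtain ⟨v, hv⟩ := A.exists_level (k + 1) hk
  obtain ⟨p⟩ := hconn u v
  obtain ⟨d, -, h₁, h₂⟩ := p.exists_boundary_dart {x | A.level x ≤ k} hu.le
    (by rw [Set.mem_ofPred_eq, hv]; omega)
  rw [Set.mem_ofPred_eq] at h₁ h₂
  have hd := A.eq_partner_of_adj hc d.adj (by omega)
  have := A.level_partner hc d.fst
  rw [← hd] at this
  exact ⟨d.fst, ⟨_, d.adj, by omega⟩, by omega⟩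

theorem exists_mem_ins (hconn : G.Preconnected) {k : ℕ} (hk : k < n) :
    ∃ v ∈ A.ins, A.level v = k + 1 := by
  obtain ⟨v, hv, hl⟩ := A.exists_mem_outs hc hconn hk
  exact ⟨_, (A.partner_mem_ins hc).2 hv, by rw [(A.mem_outs_iff hc).1 hv, hl]⟩

theorem mem_ins_of_level_eq {v : V} (h : A.level v = n) : v ∈ A.ins := by
  rw [A.mem_ins_iff_notMem_outs hc, A.mem_outs_iff hc]
  have := A.level_le (A.partner v)
  omega

theorem mem_outs_of_level_eq_zero {v : V} (h : A.level v = 0) : v ∈ A.outs := by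
  by_contra h'
  rw [← A.mem_ins_iff_notMem_outs hc, A.mem_ins_iff hc] at h'
  omega

end AnnularEmbedding

/-! ### Faces and Euler's formula -/

namespace AnnularEmbedding

variable {V : Type*} [Finite V] {G : SimpleGraph V} {n : ℕ} (A : AnnularEmbedding G n)

/-- The dart from `v` to the next vertex on its curve. -/
def nextDart (v : V) : G.Dart := ⟨(v, A.next v), A.adj_next v⟩

/-- The dart from `v` to the previous vertex on its curve. -/
def prevDart (v : V) : G.Dart := ⟨(v, A.next.symm v), A.adj_next_symm v⟩

theorem symm_nextDart (v : V) : (A.nextDart v).symm = A.prevDart (A.next v) := by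
  ext <;> simp [nextDart, prevDart]

theorem symm_prevDart (v : V) : (A.prevDart v).symm = A.nextDart (A.next.symm v) := by
  ext <;> simp [nextDart, prevDart]

theorem facePerm_eq_iff (d e : G.Dart) : A.facePerm d = e ↔ A.rot e = d.symm := by
  change A.rot.symm d.symm = e ↔ _
  rw [Equiv.symm_apply_eq, eq_comm]

theorem leftFace_facePerm (d : G.Dart) : A.leftFace (A.facePerm d) = A.leftFace d :=
  Quotient.sound (Equiv.Perm.sameCycle_apply_left.2 (Equiv.Perm.SameCycle.refl _ _))

/-- Used for tracing faces: the embedding prescribes values of `rot`, whereas `facePerm` involves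
its inverse. -/
theorem leftFace_eq_of_rot {d e : G.Dart} (h : A.rot e = d.symm) : A.leftFace d = A.leftFace e := by
  rw [← (A.facePerm_eq_iff d e).2 h, A.leftFace_facePerm]

theorem fst_rot (d : G.Dart) : (A.rot d).fst = d.fst :=
  (A.sameCycle_rot_iff _ _).1 (Equiv.Perm.sameCycle_apply_left.2 (Equiv.Perm.SameCycle.refl _ _))

variable (hc : ∀ v, (G.neighborSet v).ncard = 3)

/-- The dart from `v` to its partner. -/
noncomputable def crossDart (v : V) : G.Dart := ⟨(v, A.partner v), A.adj_partner hc v⟩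

theorem symm_crossDart (v : V) : (A.crossDart hc v).symm = A.crossDart hc (A.partner v) := by
  ext <;> simp [crossDart, A.partner_partner hc]

theorem dart_cases (d : G.Dart) :
    d = A.nextDart d.fst ∨ d = A.prevDart d.fst ∨ d = A.crossDart hc d.fst := by
  rcases A.eq_of_adj hc d.adj with h | h | h
  · exact Or.inl (Dart.ext _ _ (Prod.ext rfl h))
  · exact Or.inr (Or.inl (Dart.ext _ _ (Prod.ext rfl h)))
  · exact Or.inr (Or.inr (Dart.ext _ _ (Prod.ext rfl h)))

theorem nextDart_ne_prevDart (v : V) : A.nextDart v ≠ A.prevDart v := fun h =>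
  A.next_symm_ne_next v (congrArg (fun d : G.Dart => d.snd) h).symm

theorem crossDart_ne_nextDart (v : V) : A.crossDart hc v ≠ A.nextDart v := fun h =>
  A.partner_ne_next hc v (congrArg (fun d : G.Dart => d.snd) h)

theorem crossDart_ne_prevDart (v : V) : A.crossDart hc v ≠ A.prevDart v := fun h =>
  A.partner_ne_next_symm hc v (congrArg (fun d : G.Dart => d.snd) h)

/-- If a permutation of the three darts at a vertex is transitive, the image of one of them
determines it. -/
theorem rot_eq_of_rot_eq {a b c : G.Dart} (hab : a.fst = b.fst)
    (hac : a.fst = c.fst) (h1 : a ≠ b) (h2 : b ≠ c) (h3 : a ≠ c)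
    (hall : ∀ d : G.Dart, d.fst = a.fst → d = a ∨ d = b ∨ d = c) (h : A.rot a = b) :
    A.rot b = c ∧ A.rot c = a := by
  have hb : A.rot b = c := by
    rcases hall (A.rot b) ((A.fst_rot b).trans hab.symm) with hb | hb | hb
    -- Otherwise the orbit of `a` would be `{a, b}`, missing `c`.
    · exfalso
      have : Finite G.Dart := Finite.of_injective _ Dart.toProd_injective
      obtain ⟨m, -, hm⟩ := ((A.sameCycle_rot_iff a c).2 hac).exists_pow_eq'
      have key : ∀ i : ℕ, (A.rot ^ i) a = a ∨ (A.rot ^ i) a = b := by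
        intro i
        induction i with
        | zero => exact Or.inl rfl
        | succ i ih =>
          rw [pow_succ', Equiv.Perm.mul_apply]
          rcases ih with ih | ih
          · exact Or.inr (by rw [ih, h])
          · exact Or.inl (by rw [ih, hb])
      rcases key m with h' | h'
      · exact h3 (h'.symm.trans hm)
      · exact h2 (h'.symm.trans hm)
    · exact (h1 (A.rot.injective (h.trans hb.symm))).elim
    · exact hb
  refine ⟨hb, ?_⟩
  rcases hall (A.rot c) ((A.fst_rot c).trans hac.symm) with h' | h' | h'
  · exact h'
  · exact (h3 (A.rot.injective (h.trans h'.symm))).elim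
  · exact (h2 (A.rot.injective (hb.trans h'.symm))).elim

theorem rot_of_mem_outs {v : V} (hv : v ∈ A.outs) :
    A.rot (A.crossDart hc v) = A.nextDart v ∧ A.rot (A.nextDart v) = A.prevDart v ∧
      A.rot (A.prevDart v) = A.crossDart hc v := by
  have h : A.rot (A.crossDart hc v) = A.nextDart v :=
    Dart.ext _ _ (Prod.ext (A.fst_rot _) (A.rot_outward _ ((A.mem_outs_iff hc).1 hv)))
  refine ⟨h, A.rot_eq_of_rot_eq rfl rfl (A.crossDart_ne_nextDart hc v) (A.nextDart_ne_prevDart v)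
    (A.crossDart_ne_prevDart hc v) ?_ h⟩
  intro d hd
  have := A.dart_cases hc d
  rw [hd] at this
  tauto

theorem rot_of_mem_ins {v : V} (hv : v ∈ A.ins) :
    A.rot (A.crossDart hc v) = A.prevDart v ∧ A.rot (A.prevDart v) = A.nextDart v ∧
      A.rot (A.nextDart v) = A.crossDart hc v := by
  have h : A.rot (A.crossDart hc v) = A.prevDart v :=
    Dart.ext _ _ (Prod.ext (A.fst_rot _) (A.rot_inward _ ((A.mem_ins_iff hc).1 hv)))
  refine ⟨h, A.rot_eq_of_rot_eq rfl rfl (A.crossDart_ne_prevDart hc v)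
    (A.nextDart_ne_prevDart v).symm (A.crossDart_ne_nextDart hc v) ?_ h⟩
  intro d hd
  have := A.dart_cases hc d
  rw [hd] at this
  tauto

/-- A face that runs along a curve in counterclockwise direction leaves it at the first vertex with
an edge to the next smaller curve. -/
theorem leftFace_nextDart {v w : V} (h : A.Follows A.ins v w) :
    A.leftFace (A.nextDart v) = A.leftFace (A.crossDart hc w) := by
  obtain ⟨hw, m, rfl, hm⟩ := h
  have key : ∀ i ≤ m, A.leftFace (A.nextDart v) = A.leftFace (A.nextDart (A.next^[i] v)) := by
    intro i
    induction i with
    | zero => intro _; rfl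
    | succ i ih =>
      intro hi
      rw [ih (by omega)]
      apply A.leftFace_eq_of_rot
      have h := hm i (by omega)
      rw [A.mem_ins_iff_notMem_outs hc, not_not] at h
      rw [(A.rot_of_mem_outs hc h).2.1, A.symm_nextDart, ← iterate_succ_apply' A.next]
  rw [key m le_rfl]
  apply A.leftFace_eq_of_rot
  rw [(A.rot_of_mem_ins hc hw).1, A.symm_nextDart, ← iterate_succ_apply' A.next]

/-- A face that runs along a curve in clockwise direction leaves it at the first vertex with an edge
to the next larger curve. -/
theorem leftFace_prevDart {u : V} (hu : u ∈ A.outs) (m : ℕ)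
    (hm : ∀ i < m, A.next^[i + 1] u ∉ A.outs) :
    A.leftFace (A.prevDart (A.next^[m + 1] u)) = A.leftFace (A.crossDart hc u) := by
  induction m with
  | zero =>
    apply A.leftFace_eq_of_rot
    rw [(A.rot_of_mem_outs hc hu).1, A.symm_prevDart, zero_add, iterate_one,
      Equiv.symm_apply_apply]
  | succ m ih =>
    rw [← ih fun i hi => hm i (by omega)]
    apply A.leftFace_eq_of_rot
    have h := hm m (by omega)
    rw [← A.mem_ins_iff_notMem_outs hc] at h
    rw [(A.rot_of_mem_ins hc h).2.1, A.symm_prevDart, iterate_succ_apply' A.next (m + 1),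
      Equiv.symm_apply_apply]

theorem leftFace_crossDart_of_mem_outs {v : V} (hv : v ∈ A.outs) :
    A.leftFace (A.crossDart hc v) = A.leftFace (A.nextDart (A.partner v)) := by
  apply A.leftFace_eq_of_rot
  rw [(A.rot_of_mem_ins hc ((A.partner_mem_ins hc).2 hv)).2.2, A.symm_crossDart]

theorem leftFace_crossDart_of_mem_ins {v : V} (hv : v ∈ A.ins) :
    A.leftFace (A.crossDart hc v) = A.leftFace (A.prevDart (A.partner v)) := by
  apply A.leftFace_eq_of_rot
  rw [(A.rot_of_mem_outs hc ((A.partner_mem_outs hc).2 hv)).2.2, A.symm_crossDart]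

include hc in
-- All edges off curve `0` point outwards, so a face on its inner side never leaves the curve.
theorem leftFace_nextDart_eq_of_level_eq_zero {u v : V} (hu : A.level u = 0)
    (hv : A.level v = 0) : A.leftFace (A.nextDart u) = A.leftFace (A.nextDart v) := by
  refine A.curve_induction (P := fun x => A.leftFace (A.nextDart u) = A.leftFace (A.nextDart x))
    (hu.trans hv.symm) rfl fun x hx h => ?_
  rw [h]
  apply A.leftFace_eq_of_rot
  rw [(A.rot_of_mem_outs hc (A.mem_outs_of_level_eq_zero hc
    ((A.level_next x).trans (hx.trans hu)))).2.1, A.symm_nextDart]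

include hc in
theorem leftFace_prevDart_eq_of_level_eq {u v : V} (hu : A.level u = n)
    (hv : A.level v = n) : A.leftFace (A.prevDart u) = A.leftFace (A.prevDart v) := by
  refine A.curve_induction (P := fun x => A.leftFace (A.prevDart u) = A.leftFace (A.prevDart x))
    (hu.trans hv.symm) rfl fun x hx h => ?_
  rw [h]
  symm
  apply A.leftFace_eq_of_rot
  rw [(A.rot_of_mem_ins hc (A.mem_ins_of_level_eq hc (hx.trans hu))).2.1, A.symm_prevDart,
    Equiv.symm_apply_apply]

/-- Apart from the interior and the exterior face, every face lies to the left of an edge that leads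
to the next larger curve. -/
theorem exists_leftFace_crossDart (hconn : G.Preconnected) {u₀ u₁ : V} (h₀ : A.level u₀ = 0)
    (h₁ : A.level u₁ = n) (d : G.Dart) :
    A.leftFace (A.nextDart u₀) = A.leftFace d ∨ A.leftFace (A.prevDart u₁) = A.leftFace d ∨
      ∃ v ∈ A.outs, A.leftFace (A.crossDart hc v) = A.leftFace d := by
  have hprev : ∀ v, A.leftFace (A.prevDart u₁) = A.leftFace (A.prevDart v) ∨
      ∃ u ∈ A.outs, A.leftFace (A.crossDart hc u) = A.leftFace (A.prevDart v) := by
    intro v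
    rcases (A.level_le v).eq_or_lt with hv | hv
    · exact Or.inl (A.leftFace_prevDart_eq_of_level_eq hc h₁ hv)
    · obtain ⟨s, hs, hsv⟩ := A.exists_mem_outs hc hconn hv
      obtain ⟨u, hu, m, rfl, hm⟩ := A.exists_iterate_eq_of_mem hs hsv
      exact Or.inr ⟨u, hu, (A.leftFace_prevDart hc hu m hm).symm⟩
  have hcross : ∀ v, A.leftFace (A.prevDart u₁) = A.leftFace (A.crossDart hc v) ∨
      ∃ u ∈ A.outs, A.leftFace (A.crossDart hc u) = A.leftFace (A.crossDart hc v) := by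
    intro v
    by_cases hv : v ∈ A.outs
    · exact Or.inr ⟨v, hv, rfl⟩
    · rw [A.leftFace_crossDart_of_mem_ins hc ((A.mem_ins_iff_notMem_outs hc).2 hv)]
      exact hprev _
  rcases A.dart_cases hc d with h | h | h
  · rw [h]
    rcases Nat.eq_zero_or_pos (A.level d.fst) with hv | hv
    · exact Or.inl (A.leftFace_nextDart_eq_of_level_eq_zero hc h₀ hv)
    · have := A.level_le d.fst
      obtain ⟨s, hs, hsv⟩ := A.exists_mem_ins hc hconn (k := A.level d.fst - 1) (by omega)
      obtain ⟨w, hw⟩ := A.exists_follows (u := d.fst) hs (by omega)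
      rw [A.leftFace_nextDart hc hw]
      exact Or.inr (hcross w)
  · rw [h]
    exact Or.inr (hprev _)
  · rw [h]
    exact Or.inr (hcross _)

include hc in
-- `partner` is an involution exchanging `outs` and its complement `ins`.
theorem card_outs : Nat.card V = 2 * A.outs.ncard := by
  have h1 : A.ins = A.outsᶜ := Set.ext fun v => A.mem_ins_iff_notMem_outs hc
  have h2 : A.partner '' A.outs = A.ins := by
    ext w
    constructor
    · rintro ⟨v, hv, rfl⟩
      exact (A.partner_mem_ins hc).2 hv
    · intro hw
      exact ⟨_, (A.partner_mem_outs hc).2 hw, A.partner_partner hc w⟩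
  have h3 : A.ins.ncard = A.outs.ncard := by
    rw [← h2]
    exact Set.ncard_image_of_injective _ (LeftInverse.injective (A.partner_partner hc))
  rw [← Set.ncard_add_ncard_compl A.outs, ← h1, h3, two_mul]

include hc in
theorem two_mul_card_edgeSet : 2 * Nat.card G.edgeSet = 3 * Nat.card V := by
  classical
  have := Fintype.ofFinite V
  have h := G.sum_degrees_eq_twice_card_edges
  have hdeg : ∀ v, G.degree v = 3 := by
    intro v
    rw [← hc v, ← G.card_neighborSet_eq_degree, ← Nat.card_eq_fintype_card, Nat.card_coe_set_eq]
  rw [Finset.sum_congr rfl (fun v _ => hdeg v), Finset.sum_const, smul_eq_mul,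
    Finset.card_univ] at h
  rw [Nat.card_eq_fintype_card, Nat.card_eq_fintype_card, ← G.edgeFinset_card, ← h, mul_comm]

include hc in
-- Euler's formula with one component, no isolated vertex, `2E = 3V` and `V = 2 |outs|`.
theorem card_face (hconn : G.Connected) : Nat.card A.Face = A.outs.ncard + 2 := by
  have heuler : Nat.card V + (Nat.card A.Face + Nat.card {v : V // ∀ w, ¬ G.Adj v w}) =
    Nat.card G.edgeSet + 2 * Nat.card G.ConnectedComponent := A.euler
  have h1 : Nat.card {v : V // ∀ w, ¬ G.Adj v w} = 0 := by
    have : IsEmpty {v : V // ∀ w, ¬ G.Adj v w} := ⟨fun v => v.2 _ (A.adj_next v.1)⟩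
    exact Nat.card_of_isEmpty
  have h2 : Nat.card G.ConnectedComponent = 1 := by
    have := hconn.preconnected.subsingleton_connectedComponent
    have := hconn.nonempty
    exact Nat.card_eq_one_iff_unique.2 ⟨inferInstance, inferInstance⟩
  have h3 := A.card_outs hc
  have h4 := two_mul_card_edgeSet hc
  omega

/-- By Euler's formula, different edges to larger curves have different faces to their left. -/
theorem leftFace_crossDart_injOn (hconn : G.Connected) {u v : V} (hu : u ∈ A.outs)
    (hv : v ∈ A.outs) (h : A.leftFace (A.crossDart hc u) = A.leftFace (A.crossDart hc v)) :
    u = v := by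
  obtain ⟨u₀, h₀⟩ := A.exists_level 0 (Nat.zero_le _)
  obtain ⟨u₁, h₁⟩ := A.exists_level n le_rfl
  -- The interior face, the exterior face, and the faces to the left of outward edges: a surjection
  -- onto the faces from a set of the same size, hence a bijection.
  let Φ : Option (Option A.outs) → A.Face := fun o =>
    o.elim (A.leftFace (A.nextDart u₀)) fun o =>
      o.elim (A.leftFace (A.prevDart u₁)) fun v => A.leftFace (A.crossDart hc v)
  have hsurj : Surjective Φ := by
    rintro ⟨d⟩
    rcases A.exists_leftFace_crossDart hc hconn.preconnected h₀ h₁ d with h | h | ⟨v, hv, h⟩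
    · exact ⟨none, h⟩
    · exact ⟨some none, h⟩
    · exact ⟨some (some ⟨v, hv⟩), h⟩
  have hbij := hsurj.bijective_of_nat_card_le (by
    rw [Finite.card_option, Finite.card_option, Nat.card_coe_set_eq, A.card_face hc hconn])
  have := hbij.injective (a₁ := some (some ⟨u, hu⟩)) (a₂ := some (some ⟨v, hv⟩)) h
  simpa using this

include hc in
/-- Successive edges from a curve to the next larger one have successive end vertices there. -/
theorem partner_eq_of_follows (hconn : G.Connected) {v v' w' : V} (hv : v ∈ A.outs)
    (hv' : A.Follows A.outs v v') (hw' : A.Follows A.ins (A.partner v) w') :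
    A.partner w' = v' := by
  have hw := hw'.1
  have hlevel : A.level v = A.level (A.partner w') := by
    have h1 := hw'.level_eq
    have h2 := (A.mem_ins_iff hc).1 hw
    have h3 := (A.mem_outs_iff hc).1 hv
    omega
  obtain ⟨u, hu, m, hm, hm'⟩ := A.exists_iterate_eq_of_mem hv hlevel
  -- Walk around the face: out along the edge at `v`, counterclockwise to `w'`, back in, then
  -- clockwise to the last outward vertex `u`.
  have hface : A.leftFace (A.crossDart hc v) = A.leftFace (A.crossDart hc u) := by
    rw [A.leftFace_crossDart_of_mem_outs hc hv, A.leftFace_nextDart hc hw',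
      A.leftFace_crossDart_of_mem_ins hc hw, ← hm, A.leftFace_prevDart hc hu m hm']
  obtain rfl := A.leftFace_crossDart_injOn hc hconn hv hu hface
  exact Follows.unique ⟨(A.partner_mem_outs hc).2 hw, m, hm, hm'⟩ hv'

end AnnularEmbedding

/-! ### Colours along the curves -/

namespace AnnularEmbedding

variable {V : Type*} [Finite V] {G : SimpleGraph V} {n : ℕ} (A : AnnularEmbedding G n)
  (hc : ∀ v, (G.neighborSet v).ncard = 3)

include hc

theorem mem_innerVerts_iff {k : ℕ} {v : V} :
    v ∈ A.innerVerts (k + 1) ↔ A.level v < k ∨ (A.level v = k ∧ v ∈ A.ins) := by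
  have hlp := A.level_partner hc v
  rw [A.mem_ins_iff hc]
  constructor
  · rintro ⟨hs, hl⟩
    have := hs _ (A.adj_partner hc v)
    rw [Crosses] at this
    omega
  · intro h
    refine ⟨fun w hw hcr => ?_, by omega⟩
    rw [Crosses] at hcr
    obtain rfl := A.eq_partner_of_adj hc hw (by omega)
    omega

/-- The graph inside an annulus other than the innermost one, after deletion of the edges in this
annulus, is a Barnette graph. -/
theorem isBarnette_erase_innerVerts (hconn : G.Preconnected) (hA : A.IsAnnularConnected) {k : ℕ}
    (hk : 1 ≤ k) (hkn : k < n) : IsBarnette (A.erase (A.innerVerts (k + 1))) := by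
  obtain ⟨w, hw, hl⟩ := A.exists_mem_ins hc hconn (k := k - 1) (by omega)
  have hw' : w ∈ A.innerVerts (k + 1) := (A.mem_innerVerts_iff hc).2 (Or.inr ⟨by omega, hw⟩)
  rcases hA.2 (k + 1) (by omega) (by omega) with h | h | h
  · exact h.1
  · rw [h.1] at hw'
    exact hw'.elim
  · exact h.1

variable {c : V → Fin 2} (hcol : ∀ u v, G.Adj u v → c u ≠ c v)

include hcol

/-- Successive vertices with edges to the next larger curve have different colours. -/
theorem color_ne_of_follows_outs (hconn : G.Connected) (hA : A.IsAnnularConnected) {v v' : V}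
    (hv : v ∈ A.outs) (hv' : A.Follows A.outs v v') : c v ≠ c v' := by
  have hw := (A.partner_mem_ins hc).2 hv
  have hlw := (A.mem_outs_iff hc).1 hv
  obtain ⟨w', hw'⟩ := A.exists_follows hw rfl
  have hp := A.partner_eq_of_follows hc hconn hv hv' hw'
  have hpw : A.partner v' = w' := by rw [← hp, A.partner_partner hc]
  have hvv := hv'.level_eq
  have hvadj := hcol _ _ (A.adj_partner hc v)
  have hvadj' := hcol _ _ (A.adj_partner hc v')
  rw [hpw] at hvadj'
  rcases (A.level_le (A.partner v)).eq_or_lt with hn | hn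
  -- The outermost curve has no annulus beyond it, but all its vertices point inwards, so `w'` is
  -- the neighbour of `partner v` on the curve.
  · have := hw'.unique (follows_next (A.mem_ins_of_level_eq hc ((A.level_next _).trans hn)))
    have hadj := hcol _ _ (A.adj_next (A.partner v))
    rw [← this] at hadj
    omega
  -- Deleting the annulus just outside the curve of `partner v` removes exactly the outward vertices
  -- of that curve, making `partner v` and `w'` neighbours.
  · have hB := A.isBarnette_erase_innerVerts hc hconn.preconnected hA (k := A.level (A.partner v))
      (by omega) hn
    set S := A.innerVerts (A.level (A.partner v) + 1) with hS
    have hmem : ∀ x, A.level x = A.level v → x ∈ S := fun x hx =>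
      (A.mem_innerVerts_iff hc).2 (Or.inl (by omega))
    have hmem' : ∀ x, A.level x = A.level (A.partner v) → (x ∈ S ↔ x ∈ A.ins) := fun x hx => by
      rw [hS, A.mem_innerVerts_iff hc]
      simp [hx]
    have hfol : ∀ x y, A.level x = A.level (A.partner v) → A.Follows S x y → A.Follows A.ins x y := by
      rintro x _ hx ⟨hy, m, rfl, hm⟩
      have hl := fun i => (A.level_iterate i x).trans hx
      exact ⟨(hmem' _ (hl _)).1 hy, m, rfl, fun i hi h => hm i hi ((hmem' _ (hl _)).2 h)⟩
    have hfol' : A.Follows S (A.partner v) w' := by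
      obtain ⟨hy, m, rfl, hm⟩ := hw'
      have hl := fun i => A.level_iterate i (A.partner v)
      exact ⟨(hmem' _ (hl _)).2 hy, m, rfl, fun i hi h => hm i hi ((hmem' _ (hl _)).1 h)⟩
    have hwS : A.partner v ∈ S := (hmem' _ rfl).2 hw
    have hwS' : w' ∈ S := hfol'.1
    -- Were they equal, `partner v` would be alone on its curve and have degree at most one in a
    -- cubic graph.
    have hne : A.partner v ≠ w' := by
      intro heq
      have hsub : (A.erase S).neighborSet ⟨A.partner v, hwS⟩ ⊆ {⟨v, hmem v rfl⟩} := by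
        rintro ⟨u, hu⟩ ⟨hne, h⟩
        rw [Set.mem_singleton_iff, Subtype.mk.injEq]
        rcases h with ⟨h, hl⟩ | h | h
        · exact (A.eq_partner_of_adj hc h hl).trans (A.partner_partner hc v)
        · exact (hne (Subtype.ext (heq.trans (hw'.unique (hfol _ _ rfl h))))).elim
        · have hu' := hfol _ _ h.level_eq.symm h
          rw [← heq] at hw'
          have := hw'.left_unique hw ((hmem' _ h.level_eq.symm).1 hu) hu'
          exact (hne (Subtype.ext this)).elim
      have := Set.ncard_le_ncard hsub
      rw [hB.cubic, Set.ncard_singleton] at this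
      omega
    obtain ⟨C⟩ := hB.bipartite
    have hC : ∀ x y (hx : x ∈ S) (hy : y ∈ S), x ≠ y →
        ((G.Adj x y ∧ A.level x ≠ A.level y) ∨ A.Follows S x y) → C ⟨x, hx⟩ ≠ C ⟨y, hy⟩ := by
      intro x y hx hy hxy h
      exact C.valid ⟨fun h => hxy (congrArg Subtype.val h), h.imp_right Or.inl⟩
    have h1 := hC v (A.partner v) (hmem v rfl) hwS (A.adj_partner hc v).ne
      (Or.inl ⟨A.adj_partner hc v, by omega⟩)
    have h2 := hC (A.partner v) w' hwS hwS' hne (Or.inr hfol')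
    have h3 := hC v' w' (hmem v' hvv) hwS' (hpw ▸ (A.adj_partner hc v').ne)
      (Or.inl ⟨hpw ▸ A.adj_partner hc v', by have := hw'.level_eq; omega⟩)
    -- The curve of `v` survives whole, so `C` and `c` both alternate along it and agree on which of
    -- its vertices have the same colour as `v`.
    have key : ∀ (hx : v' ∈ S), C ⟨v, hmem v rfl⟩ = C ⟨v', hx⟩ ↔ c v = c v' := by
      refine A.curve_induction (P := fun x => ∀ (hx : x ∈ S), C ⟨v, hmem v rfl⟩ = C ⟨x, hx⟩ ↔ c v = c x)
        hvv.symm (fun _ => by simp) ?_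
      intro x hx ih hxS
      have h4 := ih (hmem x hx)
      have h5 := hC x (A.next x) (hmem x hx) hxS (A.adj_next x).ne (Or.inr (follows_next hxS))
      have h6 := hcol _ _ (A.adj_next x)
      generalize C ⟨A.next x, hxS⟩ = a1 at *
      generalize C ⟨x, hmem x hx⟩ = a2 at *
      generalize C ⟨v, hmem v rfl⟩ = a3 at *
      omega
    have := key (hmem v' hvv)
    intro heq
    rw [← this] at heq
    omega

/-- Successive vertices with edges to the next smaller curve have different colours. -/
theorem color_ne_of_follows_ins (hconn : G.Connected) (hA : A.IsAnnularConnected) {w w' : V}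
    (hw : w ∈ A.ins) (hw' : A.Follows A.ins w w') : c w ≠ c w' := by
  have hv := (A.partner_mem_outs hc).2 hw
  obtain ⟨v', hv'⟩ := A.exists_follows hv rfl
  have hpw := A.partner_partner hc w
  have hp := A.partner_eq_of_follows hc hconn hv hv' (hpw.symm ▸ hw')
  have h1 := A.color_ne_of_follows_outs hc hcol hconn hA hv hv'
  have h2 := hcol _ _ (A.adj_partner hc w)
  have h3 := hcol _ _ (A.adj_partner hc w')
  rw [hp] at h3
  omega

/-- On every curve, the vertices after which the direction of the edges to other curves changes all
have the same colour. -/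
theorem exists_color_of_change (hconn : G.Connected) (hA : A.IsAnnularConnected) (k : ℕ) :
    ∃ t : Fin 2, ∀ x, A.level x = k → ¬ (A.next x ∈ A.outs ↔ x ∈ A.outs) → c x = t := by
  by_cases hex : ∃ z, A.level z = k ∧ ¬ (A.next z ∈ A.outs ↔ z ∈ A.outs)
  swap
  · exact ⟨0, fun x hx h => (hex ⟨x, hx, h⟩).elim⟩
  obtain ⟨z₀, hz₀, hch₀⟩ := hex
  -- The alternation lemmas for both directions at once: `y` is the first vertex after `z` with the
  -- same direction.
  have hpar : ∀ z y m, A.next^[m + 1] z = y → (y ∈ A.outs ↔ z ∈ A.outs) →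
      (∀ i < m, ¬ (A.next^[i + 1] z ∈ A.outs ↔ z ∈ A.outs)) → c z ≠ c y := by
    intro z y m hm hy hi
    by_cases hz : z ∈ A.outs
    · simp only [hz, iff_true] at hy hi
      exact A.color_ne_of_follows_outs hc hcol hconn hA hz ⟨hy, m, hm, hi⟩
    · simp only [hz, iff_false, ← A.mem_ins_iff_notMem_outs hc] at hy hi
      exact A.color_ne_of_follows_ins hc hcol hconn hA ((A.mem_ins_iff_notMem_outs hc).2 hz)
        ⟨hy, m, hm, hi⟩
  refine ⟨c z₀, fun x hx => ?_⟩
  -- Here `z` is the last change before `x`. If the next change is at `x`, then `next x` is the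
  -- first vertex after `z` with its direction, so `c z ≠ c (next x)` and `c z = c x`.
  have key : ∃ z m, A.next^[m + 1] z = x ∧ c z = c z₀ ∧
      ∀ i < m + 1, ¬ (A.next^[i + 1] z ∈ A.outs ↔ z ∈ A.outs) := by
    refine A.curve_induction (u := A.next z₀) (P := fun x => ∃ z m, A.next^[m + 1] z = x ∧
      c z = c z₀ ∧ ∀ i < m + 1, ¬ (A.next^[i + 1] z ∈ A.outs ↔ z ∈ A.outs))
      ((A.level_next z₀).trans (hz₀.trans hx.symm)) ⟨z₀, 0, rfl, rfl, ?_⟩ ?_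
    · intro i hi
      obtain rfl : i = 0 := by omega
      exact hch₀
    · rintro x - ⟨z, m, rfl, hz, hm⟩
      by_cases hch : A.next (A.next^[m + 1] z) ∈ A.outs ↔ A.next^[m + 1] z ∈ A.outs
      · refine ⟨z, m + 1, iterate_succ_apply' _ _ _, hz, fun i hi => ?_⟩
        rcases Nat.lt_succ_iff_lt_or_eq.1 hi with hi | rfl
        · exact hm i hi
        · rw [iterate_succ_apply', hch]
          exact hm m (by omega)
      · refine ⟨A.next^[m + 1] z, 0, rfl, ?_, ?_⟩
        · have h1 := hpar z (A.next (A.next^[m + 1] z)) (m + 1) (iterate_succ_apply' _ _ _)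
            (by have := hm m (by omega); tauto) hm
          have h2 := hcol _ _ (A.adj_next (A.next^[m + 1] z))
          omega
        · intro i hi
          obtain rfl : i = 0 := by omega
          exact hch
  intro hch
  obtain ⟨z, m, rfl, hz, hm⟩ := key
  have h1 := hpar z (A.next (A.next^[m + 1] z)) (m + 1) (iterate_succ_apply' _ _ _)
    (by have := hm m (by omega); tauto) hm
  have h2 := hcol _ _ (A.adj_next (A.next^[m + 1] z))
  omega

end AnnularEmbedding

/-! ### Growing the cycle curve by curve -/

/-- `v` is reached from `u` by iterating `f`. -/
def Reaches {V : Type*} (f : V → V) (u v : V) : Prop := ∃ m, f^[m] u = v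

namespace Reaches

variable {V : Type*} {f : V → V} {u v w : V}

theorem refl (f : V → V) (u : V) : Reaches f u u := ⟨0, rfl⟩

theorem apply (f : V → V) (u : V) : Reaches f u (f u) := ⟨1, rfl⟩

theorem trans : Reaches f u v → Reaches f v w → Reaches f u w := by
  rintro ⟨m, rfl⟩ ⟨k, rfl⟩
  exact ⟨k + m, iterate_add_apply _ _ _ _⟩

/-- If `f'` reaches `f u` from every `u ∈ S`, then it reaches whatever `f` reaches. -/
theorem of_forall {f' : V → V} {S : Set V} (hS : Set.MapsTo f S S)
    (h : ∀ u ∈ S, Reaches f' u (f u)) (hu : u ∈ S) : Reaches f u v → Reaches f' u v := by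
  rintro ⟨m, rfl⟩
  induction m with
  | zero => exact refl _ _
  | succ m ih =>
    rw [iterate_succ_apply']
    exact ih.trans (h _ (hS.iterate m hu))

end Reaches

namespace AnnularEmbedding

variable {V : Type*} [Finite V] {G : SimpleGraph V} {n : ℕ} (A : AnnularEmbedding G n)

/-- `f` runs along a cycle of `G` through all vertices on the curves `0, …, k`. It follows the curve
`k` counterclockwise along the edges between vertices with edges to the next larger curve. -/
structure IsCycleMap (k : ℕ) (f : V → V) : Prop where
  level_le : ∀ v, A.level v ≤ k → A.level (f v) ≤ k
  adj : ∀ v, A.level v ≤ k → G.Adj v (f v)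
  reaches : ∀ u v, A.level u ≤ k → A.level v ≤ k → Reaches f u v
  next : ∀ v, A.level v = k → v ∈ A.outs → A.next v ∈ A.outs → f v = A.next v

theorem isCycleMap_zero : A.IsCycleMap 0 A.next where
  level_le v hv := by rwa [A.level_next]
  adj v _ := A.adj_next v
  reaches u v hu hv := by
    obtain ⟨m, hm⟩ := A.exists_iterate_eq (u := u) (v := v) (by omega)
    exact ⟨_, hm⟩
  next _ _ _ _ := rfl

variable {A} in
/-- A cycle through the curves `0, …, k` extends to the curve `k + 1` if every vertex there is
reached from, and reaches, the smaller curves. -/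
theorem IsCycleMap.reaches_of_extension {k : ℕ} {f f' : V → V} (hf : A.IsCycleMap k f)
    (hstep : ∀ u, A.level u ≤ k → Reaches f' u (f u))
    (hto : ∀ x, A.level x = k + 1 → ∃ y, A.level y ≤ k ∧ Reaches f' x y)
    (hfrom : ∀ x, A.level x = k + 1 → ∃ y, A.level y ≤ k ∧ Reaches f' y x)
    (u v : V) (hu : A.level u ≤ k + 1) (hv : A.level v ≤ k + 1) : Reaches f' u v := by
  obtain ⟨y, hy, huy⟩ : ∃ y, A.level y ≤ k ∧ Reaches f' u y := by
    rcases Nat.le_succ_iff.1 hu with hu | hu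
    exacts [⟨u, hu, Reaches.refl _ _⟩, hto u hu]
  obtain ⟨z, hz, hzv⟩ : ∃ y, A.level y ≤ k ∧ Reaches f' y v := by
    rcases Nat.le_succ_iff.1 hv with hv | hv
    exacts [⟨v, hv, Reaches.refl _ _⟩, hfrom v hv]
  exact huy.trans ((Reaches.of_forall (S := {x | A.level x ≤ k}) hf.level_le hstep hy
    (hf.reaches y z hy hz)).trans hzv)

variable (hc : ∀ v, (G.neighborSet v).ncard = 3) {c : V → Fin 2}
  (hcol : ∀ u v, G.Adj u v → c u ≠ c v) (hconn : G.Connected) (hA : A.IsAnnularConnected)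
include hc hcol hconn hA

/-- Colours alternate on the inward vertices of a curve, so both occur there. -/
theorem exists_mem_ins_color {k : ℕ} (hk : k < n) (b : Fin 2) :
    ∃ w ∈ A.ins, A.level w = k + 1 ∧ c w ≠ b := by
  obtain ⟨w, hw, hl⟩ := A.exists_mem_ins hc hconn.preconnected hk
  by_cases hwb : c w = b
  · obtain ⟨w', hw'⟩ := A.exists_follows hw rfl
    have := A.color_ne_of_follows_ins hc hcol hconn hA hw hw'
    exact ⟨w', hw'.1, hw'.level_eq.trans hl, fun h => this (hwb.trans h.symm)⟩
  · exact ⟨w, hw, hl, hwb⟩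

/-- If the edges to the next larger curve are attached to the faces between the `k`-th and the
`(k + 1)`-st curve whose part of the `k`-th curve is a single edge, then the cycle through the first
curves is extended by replacing all these edges by paths on the `(k + 1)`-st curve. -/
theorem IsCycleMap.exists_replace {k : ℕ} {f : V → V} (hf : A.IsCycleMap k f) (hk : k < n)
    (b : Fin 2) (hb : ∀ v ∈ A.outs, A.level v = k → c v = b → A.next v ∈ A.outs)
    (hins : ∀ w ∈ A.ins, A.level w = k + 1 → c w = b → A.next w ∈ A.ins) :
    ∃ f', A.IsCycleMap (k + 1) f' := by
  classical
  -- Go out at outward vertices of colour `b` on curve `k`; their partners have the other colour.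
  -- Run counterclockwise and come back in at inward vertices of colour `b`.
  let f' : V → V := fun x =>
    if A.level x ≤ k then if A.level x = k ∧ x ∈ A.outs ∧ c x = b then A.partner x else f x
    else if x ∈ A.ins ∧ c x = b then A.partner x else A.next x
  have e1 : ∀ x ∈ A.outs, A.level x = k → c x = b → f' x = A.partner x := fun x hx hl hxb => by
    simp only [f', if_pos hl.le, if_pos (And.intro hl (And.intro hx hxb))]
  have e2 : ∀ x, A.level x ≤ k → ¬ (A.level x = k ∧ x ∈ A.outs ∧ c x = b) → f' x = f x :=
    fun x hl h => by simp only [f', if_pos hl, if_neg h]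
  have e3 : ∀ x ∈ A.ins, A.level x = k + 1 → c x = b → f' x = A.partner x :=
    fun x hx hl hxb => by
      simp only [f', if_neg (show ¬ A.level x ≤ k by omega), if_pos (And.intro hx hxb)]
  have e4 : ∀ x, A.level x = k + 1 → ¬ (x ∈ A.ins ∧ c x = b) → f' x = A.next x :=
    fun x hl h => by simp only [f', if_neg (show ¬ A.level x ≤ k by omega), if_neg h]
  obtain ⟨w₀, hw₀, hl₀, hb₀⟩ := A.exists_mem_ins_color hc hcol hconn hA hk b
  obtain ⟨w₁, hw₁⟩ := A.exists_follows hw₀ rfl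
  have hb₁ : c w₁ = b := by
    have := A.color_ne_of_follows_ins hc hcol hconn hA hw₀ hw₁
    omega
  have hto : ∀ x, A.level x = k + 1 → ∃ y, A.level y ≤ k ∧ Reaches f' x y := by
    intro x hx
    have hend : ∀ x ∈ A.ins, A.level x = k + 1 → c x = b →
        ∃ y, A.level y ≤ k ∧ Reaches f' x y := by
      intro x hx hl hxb
      refine ⟨A.partner x, ?_, e3 x hx hl hxb ▸ Reaches.apply f' x⟩
      have := (A.mem_ins_iff hc).1 hx
      omega
    have hl₁ := hw₁.level_eq
    refine A.curve_induction_symm (u := w₁) (P := fun x => ∃ y, A.level y ≤ k ∧ Reaches f' x y)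
      (by omega) (hend w₁ hw₁.1 (by omega) hb₁) ?_
    rintro x hx ⟨y, hy, hxy⟩
    by_cases h : x ∈ A.ins ∧ c x = b
    · exact hend x h.1 (by omega) h.2
    · exact ⟨y, hy, (e4 x (by omega) h ▸ Reaches.apply f' x).trans hxy⟩
  have hfrom : ∀ x, A.level x = k + 1 → ∃ y, A.level y ≤ k ∧ Reaches f' y x := by
    intro x hx
    have hstart : ∀ x ∈ A.ins, A.level x = k + 1 → c x ≠ b →
        ∃ y, A.level y ≤ k ∧ Reaches f' y x := by
      intro x hx hl hxb
      have h1 := (A.mem_ins_iff hc).1 hx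
      have h2 := hcol _ _ (A.adj_partner hc x)
      have h3 := e1 (A.partner x) ((A.partner_mem_outs hc).2 hx) (by omega) (by omega)
      rw [A.partner_partner hc] at h3
      refine ⟨A.partner x, by omega, 1, h3⟩
    refine A.curve_induction (u := w₀) (P := fun x => ∃ y, A.level y ≤ k ∧ Reaches f' y x)
      (by omega) (hstart w₀ hw₀ hl₀ hb₀) ?_
    rintro x hx ⟨y, hy, hxy⟩
    by_cases h : x ∈ A.ins ∧ c x = b
    · have := hcol _ _ (A.adj_next x)
      exact hstart _ (hins x h.1 (by omega) h.2) (by rw [A.level_next]; omega) (by omega)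
    · exact ⟨y, hy, hxy.trans (e4 x (by omega) h ▸ Reaches.apply f' x)⟩
  -- The detour from `u` ends at the next inward vertex `w'`, of colour `b`, whose partner is `next
  -- u`.
  have hstep : ∀ u, A.level u ≤ k → Reaches f' u (f u) := by
    intro u hu
    by_cases h : A.level u = k ∧ u ∈ A.outs ∧ c u = b
    swap
    · exact e2 u hu h ▸ Reaches.apply f' u
    obtain ⟨hl, hu, hub⟩ := h
    have hnext := hb u hu hl hub
    rw [hf.next u hl hu hnext]
    refine (e1 u hu hl hub ▸ Reaches.apply f' u).trans ?_
    have hw := (A.partner_mem_ins hc).2 hu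
    obtain ⟨w', hw'⟩ := A.exists_follows hw rfl
    have hp := A.partner_eq_of_follows hc hconn hu (follows_next hnext) hw'
    have h1 := hcol _ _ (A.adj_partner hc u)
    have h2 := A.color_ne_of_follows_ins hc hcol hconn hA hw hw'
    have hlw := (A.mem_outs_iff hc).1 hu
    have hlw' := hw'.level_eq
    rw [← hp, ← e3 w' hw'.1 (by omega) (by omega)]
    refine Reaches.trans ?_ (Reaches.apply f' w')
    obtain ⟨-, m, rfl, hm⟩ := hw'
    have key : ∀ i ≤ m + 1, Reaches f' (A.partner u) (A.next^[i] (A.partner u)) := by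
      intro i
      induction i with
      | zero => exact fun _ => Reaches.refl _ _
      | succ i ih =>
        intro hi
        refine (ih (by omega)).trans ?_
        have hli := A.level_iterate i (A.partner u)
        rw [iterate_succ_apply']
        refine ⟨1, e4 _ (by omega) ?_⟩
        rintro ⟨hi1, hi2⟩
        rcases i with - | i
        · rw [iterate_zero, id] at hi2
          omega
        · exact hm i (by omega) hi1
    exact key _ le_rfl
  refine ⟨f', ?_, ?_, hf.reaches_of_extension hstep hto hfrom, ?_⟩
  · intro v hv
    have := A.level_partner hc v
    rcases Nat.le_succ_iff.1 hv with hv | hv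
    · by_cases h : A.level v = k ∧ v ∈ A.outs ∧ c v = b
      · rw [e1 v h.2.1 h.1 h.2.2]
        omega
      · rw [e2 v hv h]
        exact (hf.level_le v hv).trans (Nat.le_succ k)
    · by_cases h : v ∈ A.ins ∧ c v = b
      · rw [e3 v h.1 hv h.2]
        have := (A.mem_ins_iff hc).1 h.1
        omega
      · rw [e4 v hv h, A.level_next, hv]
  · intro v hv
    rcases Nat.le_succ_iff.1 hv with hv | hv
    · by_cases h : A.level v = k ∧ v ∈ A.outs ∧ c v = b
      · rw [e1 v h.2.1 h.1 h.2.2]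
        exact A.adj_partner hc v
      · rw [e2 v hv h]
        exact hf.adj v hv
    · by_cases h : v ∈ A.ins ∧ c v = b
      · rw [e3 v h.1 hv h.2]
        exact A.adj_partner hc v
      · rw [e4 v hv h]
        exact A.adj_next v
  · intro v hl hv _
    exact e4 v hl fun h => (A.mem_ins_iff_notMem_outs hc).1 h.1 hv

/-- If no edges to the next larger curve are attached to the faces between the `k`-th and the
`(k + 1)`-st curve whose part of the `k`-th curve is a single edge, then these faces are `4`-cycles,
and one of them connects the cycle through the first curves with the `(k + 1)`-st curve. -/
theorem IsCycleMap.exists_merge {k : ℕ} {f : V → V} (hf : A.IsCycleMap k f) (hk : k < n)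
    (b : Fin 2) (hb : ∀ v ∈ A.outs, A.level v = k → c v = b → A.next v ∈ A.outs)
    (hins : ∀ w ∈ A.ins, A.level w = k + 1 → c w ≠ b → A.next w ∈ A.ins) :
    ∃ f', A.IsCycleMap (k + 1) f' := by
  classical
  obtain ⟨w₀, hw₀, hl₀, hb₀⟩ := A.exists_mem_ins_color hc hcol hconn hA hk b
  have hw₁ := hins w₀ hw₀ hl₀ hb₀
  have hl₁ := A.level_next w₀
  obtain ⟨v₀, hv₀⟩ : ∃ v₀, v₀ = A.partner w₀ := ⟨_, rfl⟩
  have hpv : A.partner v₀ = w₀ := by rw [hv₀, A.partner_partner hc]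
  have hvouts : v₀ ∈ A.outs := hv₀ ▸ (A.partner_mem_outs hc).2 hw₀
  have hlv : A.level v₀ = k := by
    have := (A.mem_ins_iff hc).1 hw₀
    rw [← hv₀] at this
    omega
  have hcv : c v₀ = b := by
    have := hcol _ _ (A.adj_partner hc w₀)
    rw [← hv₀] at this
    omega
  have hnext := hb v₀ hvouts hlv hcv
  have hfv := hf.next v₀ hlv hvouts hnext
  have hp : A.partner (A.next w₀) = f v₀ := by
    rw [hfv]
    exact A.partner_eq_of_follows hc hconn hvouts (follows_next hnext)
      (hpv.symm ▸ follows_next hw₁)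
  have hlf : A.level (f v₀) ≤ k := hf.level_le v₀ hlv.le
  -- The edge from `v₀` to `f v₀` gives way to `v₀`, `w₀`, the whole curve `k + 1` clockwise to
  -- `next w₀`, then `f v₀`.
  let f' : V → V := fun x =>
    if A.level x ≤ k then if x = v₀ then w₀ else f x
    else if x = A.next w₀ then f v₀ else A.next.symm x
  have e1 : f' v₀ = w₀ := by simp only [f', if_pos hlv.le, if_true]
  have e2 : ∀ x, A.level x ≤ k → x ≠ v₀ → f' x = f x :=
    fun x hl h => by simp only [f', if_pos hl, if_neg h]
  have e3 : f' (A.next w₀) = f v₀ := by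
    simp only [f', if_neg (show ¬ A.level (A.next w₀) ≤ k by omega), if_true]
  have e4 : ∀ x, A.level x = k + 1 → x ≠ A.next w₀ → f' x = A.next.symm x :=
    fun x hl h => by simp only [f', if_neg (show ¬ A.level x ≤ k by omega), if_neg h]
  have hto : ∀ x, A.level x = k + 1 → Reaches f' x (f v₀) := by
    intro x hx
    refine A.curve_induction (u := A.next w₀) (P := fun x => Reaches f' x (f v₀))
      (by omega) (e3 ▸ Reaches.apply f' _) ?_
    intro x hx h
    by_cases hxw : A.next x = A.next w₀
    · rw [hxw]
      exact e3 ▸ Reaches.apply f' _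
    · have := e4 (A.next x) (by rw [A.level_next]; omega) hxw
      rw [Equiv.symm_apply_apply] at this
      exact Reaches.trans ⟨1, this⟩ h
  have hfrom : ∀ x, A.level x = k + 1 → Reaches f' v₀ x := by
    intro x hx
    refine A.curve_induction_symm (u := w₀) (P := fun x => Reaches f' v₀ x)
      (by omega) (Reaches.trans ⟨1, e1⟩ (Reaches.refl _ _)) ?_
    intro x hx h
    by_cases hxw : A.next x = A.next w₀
    · rw [A.next.injective hxw]
      exact ⟨1, e1⟩
    · have := e4 (A.next x) (by rw [A.level_next]; omega) hxw
      rw [Equiv.symm_apply_apply] at this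
      exact h.trans ⟨1, this⟩
  have hstep : ∀ u, A.level u ≤ k → Reaches f' u (f u) := by
    intro u hu
    by_cases h : u = v₀
    · rw [h]
      exact Reaches.trans ⟨1, e1⟩ (hto w₀ hl₀)
    · exact e2 u hu h ▸ Reaches.apply f' u
  have hreach := hf.reaches_of_extension hstep (fun x hx => ⟨_, hlf, hto x hx⟩)
    (fun x hx => ⟨_, hlv.le, hfrom x hx⟩)
  have hmaps : Set.MapsTo f' {x | A.level x ≤ k + 1} {x | A.level x ≤ k + 1} := by
    intro v hv
    change A.level (f' v) ≤ k + 1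
    rcases Nat.le_succ_iff.1 hv with hv | hv
    · by_cases h : v = v₀
      · rw [h, e1, hl₀]
      · rw [e2 v hv h]
        exact (hf.level_le v hv).trans (Nat.le_succ k)
    · by_cases h : v = A.next w₀
      · rw [h, e3]
        omega
      · rw [e4 v hv h, A.level_next_symm, hv]
  have hadj : ∀ v, A.level v ≤ k + 1 → G.Adj v (f' v) := by
    intro v hv
    rcases Nat.le_succ_iff.1 hv with hv | hv
    · by_cases h : v = v₀
      · rw [h, e1, ← hpv]
        exact A.adj_partner hc v₀
      · rw [e2 v hv h]
        exact hf.adj v hv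
    · by_cases h : v = A.next w₀
      · rw [h, e3, ← hp]
        exact A.adj_partner hc _
      · rw [e4 v hv h]
        exact A.adj_next_symm v
  -- This cycle runs clockwise on curve `k + 1`; its inverse restores the orientation demanded by
  -- `IsCycleMap`.
  obtain ⟨g, hg, hgf, hfg, hgreach⟩ := exists_inverse_of_transitive {x | A.level x ≤ k + 1} f' hmaps
    (fun u hu v hv => hreach u v hu hv)
  refine ⟨g, hg, fun v hv => ?_, fun u v hu hv => hgreach u hu v hv, fun v hl hv hnv => ?_⟩
  · have := hadj (g v) (hg hv)
    rw [hfg v hv] at this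
    exact this.symm
  -- The only edge of curve `k + 1` not used ends at the inward vertex `next w₀`, so the invariant
  -- does not ask for it.
  · have h1 : A.next v ≠ A.next w₀ := by
      intro h
      rw [h] at hnv
      exact (A.mem_ins_iff_notMem_outs hc).1 hw₁ hnv
    have hl' : A.level (A.next v) = k + 1 := (A.level_next v).trans hl
    have h2 := e4 (A.next v) hl' h1
    rw [Equiv.symm_apply_apply] at h2
    rw [← h2, hgf _ hl'.le, h2]

theorem exists_isCycleMap {k : ℕ} (hk : k ≤ n) : ∃ f, A.IsCycleMap k f := by
  induction k with
  | zero => exact ⟨_, A.isCycleMap_zero⟩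
  | succ k ih =>
    obtain ⟨f, hf⟩ := ih (by omega)
    obtain ⟨t, ht⟩ := A.exists_color_of_change hc hcol hconn hA k
    obtain ⟨t', ht'⟩ := A.exists_color_of_change hc hcol hconn hA (k + 1)
    -- Direction changes on curve `k` occur only after vertices of colour `t`, so after colour `b`
    -- the direction persists.
    obtain ⟨b, hbt⟩ : ∃ b : Fin 2, b ≠ t := exists_ne t
    have hb : ∀ v ∈ A.outs, A.level v = k → c v = b → A.next v ∈ A.outs := by
      intro v hv hl hvb
      by_contra h
      exact hbt (hvb.symm.trans (ht v hl fun h' => h (h'.2 hv)))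
    have hins : ∀ w ∈ A.ins, A.level w = k + 1 → c w ≠ t' → A.next w ∈ A.ins := by
      intro w hw hl hwt
      by_contra h
      rw [A.mem_ins_iff_notMem_outs hc] at hw h
      exact hwt (ht' w hl (by tauto))
    by_cases htb : t' = b
    · exact IsCycleMap.exists_merge A hc hcol hconn hA hf hk b hb (htb ▸ hins)
    · exact IsCycleMap.exists_replace A hc hcol hconn hA hf hk b hb
        fun w hw hl hwb => hins w hw hl (by rw [hwb]; exact Ne.symm htb)

end AnnularEmbedding

end BarnetteAnnular

/-! ### Hamiltonicity from the cycle through all curves -/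

theorem mainTheorem2 {V : Type*} [Fintype V] [DecidableEq V] (G : SimpleGraph V)
    (hG : BarnetteAnnular.IsBarnette G) (x y : ℕ) (hx : 1 ≤ x) (hy : 1 ≤ y)
    (A : BarnetteAnnular.AnnularEmbedding G (x + y)) (hA : A.IsAnnularConnected)
    (hblock : ∀ k, 1 ≤ k → k ≤ x → A.IsBlock k)
    (hring : ∀ k, x + 1 ≤ k → k ≤ x + y → A.IsRing k) :
    G.IsHamiltonian := by
  have hconn : G.Connected := by
    have h := hG.threeConnected.2 ∅ (by simp)
    rw [Set.compl_empty] at h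
    exact (SimpleGraph.induceUnivIso G).connected_iff.1 h
  obtain ⟨c⟩ := hG.bipartite
  obtain ⟨f, hf⟩ := A.exists_isCycleMap hG.cubic (c := c) (fun _ _ h => c.valid h) hconn hA le_rfl
  have h4 := hG.threeConnected.1
  rw [Nat.card_eq_fintype_card] at h4
  exact BarnetteAnnular.isHamiltonian_of_transitive f (fun v => hf.adj v (A.level_le v))
    (fun u v => hf.reaches u v (A.level_le u) (A.level_le v)) (by omega)
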